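/- All manifolds are finite-dimensional, Hausdorff, without boundary and of class $C^\infty$. Let $G$ be a Lie group with Lie algebra $\mathfrak g$, let $\pi : P \to M$ be a principal fibre bundle with structure group $G$ acting on $P$ on the right by $R_g(u)=ug$, and let $V=\ker d\pi$ be its vertical distribution. Let $a,b$ be positive integers and $\rho_{a,b}=\frac{a+\sqrt{a^2+4b}}{2}$. A metallic structure on $P$ is a smooth $(1,1)$-tensor field $J$ with $J^2=aJ+bI$; its Nijenhuis tensor is $$N_J(X,Y)=J^2[X,Y]+[JX,JY]-J[JX,Y]-J[X,JY].$$ A connection on $P$ is a smooth $G$-invariant distribution $H$ with $TP=V\oplus H$; let $v,h$ be the projectors onto $V,H$. Its connection form $\omega\in\Omega^1(P,\mathfrak g)$ assigns to $x\in T_uP$ the unique $A\in\mathfrak g$ with $\frac{d}{dt}\big|_{0}\,u\exp(tA)=v x$, and its curvature form is $\Omega(X,Y)=d\omega(hX,hY)$, where $d\omega(X,Y)=X\omega(Y)-Y\omega(X)-\omega([X,Y])$. The connection is flat if $\Omega\equiv 0$. We say that $H$ is described by the metallic structure $J$ (and that $J$ is associated with $H$) if (1) for all $u\in P$ and $x\in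 T_uP$: $J_ux=\rho_{a,b}x$ if and only if $x\in V_u$; (2) $dR_g\circ J_u=J_{ug}\circ dR_g$ for all $g\in G$, $u\in P$; (3) $H_u=\ker\big(J_u-(a-\rho_{a,b})I\big)$ for all $u\in P$. Then every metallic structure on $P$ satisfying (1) and (2) describes exactly one connection, and every connection on $P$ has exactly one associated metallic structure (for the given $a,b$). Moreover, if the connection $H$ is described by the metallic structure $J$, then for all smooth vector fields $X,Y$ on $P$ $$\Omega(X,Y)=-\frac{1}{(2\rho_{a,b}-a)^2}\,\omega\big(N_J(X,Y)\big),$$ and the connection is flat if and only if $J$ is integrable, i.e. $N_J(X,Y)=0$ for all smooth vector fields $X,Y$ on $P$. -/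

import Mathlib

open Set VectorField
open scoped Manifold ContDiff RightActions

noncomputable section

namespace MetallicConnection

/-- The metallic ratio: the positive root of `x ^ 2 - a * x - b = 0`. -/
def metallicRatio (a b : ℕ) : ℝ := ((a : ℝ) + Real.sqrt ((a : ℝ) ^ 2 + 4 * (b : ℝ))) / 2

section Tensors

variable {E : Type*} [NormedAddCommGroup E] [NormedSpace ℝ E]
  {H : Type*} [TopologicalSpace H] (I : ModelWithCorners ℝ E H)
  {P : Type*} [TopologicalSpace P] [ChartedSpace H P]

instance instFiniteDimensionalTangentSpace [FiniteDimensional ℝ E] (u : P) :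
    FiniteDimensional ℝ (TangentSpace I u) :=
  inferInstanceAs (FiniteDimensional ℝ E)

instance instT2SpaceTangentSpace (u : P) : T2Space (TangentSpace I u) :=
  inferInstanceAs (T2Space E)

/-- `X` is a smooth vector field. -/
def IsSmoothVectorField [IsManifold I ∞ P] (X : ∀ u : P, TangentSpace I u) : Prop :=
  ContMDiff I I.tangent ∞ (fun u => (⟨u, X u⟩ : TangentBundle I P))

/-- `J` is a smooth `(1,1)`-tensor field, i.e. a smooth section of `Hom(TP, TP)`. -/
def IsSmoothEndomorphismField [IsManifold I ∞ P]
    (J : ∀ u : P, TangentSpace I u →L[ℝ] TangentSpace I u) : Prop :=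
  ContMDiff I (I.prod 𝓘(ℝ, E →L[ℝ] E)) ∞
    (fun u => Bundle.TotalSpace.mk' (E →L[ℝ] E)
      (E := fun u : P => TangentSpace I u →L[ℝ] TangentSpace I u) u (J u))

/-- A metallic structure: a smooth `(1,1)`-tensor field with `J ^ 2 = a J + b I`. -/
structure IsMetallicStructure [IsManifold I ∞ P] (a b : ℕ)
    (J : ∀ u : P, TangentSpace I u →L[ℝ] TangentSpace I u) : Prop where
  smooth : IsSmoothEndomorphismField I J
  sq_eq : ∀ (u : P) (x : TangentSpace I u), J u (J u x) = (a : ℝ) • J u x + (b : ℝ) • x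

/-- The Nijenhuis tensor `N_J(X, Y) = J²[X, Y] + [JX, JY] - J[JX, Y] - J[X, JY]`. -/
def nijenhuis (J : ∀ u : P, TangentSpace I u →L[ℝ] TangentSpace I u)
    (X Y : ∀ u : P, TangentSpace I u) (u : P) : TangentSpace I u :=
  J u (J u (mlieBracket I X Y u))
    + mlieBracket I (fun p => J p (X p)) (fun p => J p (Y p)) u
    - J u (mlieBracket I (fun p => J p (X p)) Y u)
    - J u (mlieBracket I X (fun p => J p (Y p)) u)

/-- The exterior derivative `(dη)_u(x, y)` of an `F`-valued one-form `η`, computed in the preferred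
chart at `u`; it is normalised by `dη(X, Y) = X(η(Y)) - Y(η(X)) - η([X, Y])`. -/
def mextDeriv {F : Type*} [NormedAddCommGroup F] [NormedSpace ℝ F]
    (η : ∀ u : P, TangentSpace I u →L[ℝ] F) (u : P) (x y : TangentSpace I u) : F :=
  extDeriv (fun z : E => ContinuousAlternatingMap.ofSubsingleton ℝ E F (0 : Fin 1)
      ((η ((extChartAt I u).symm z)).comp (mfderiv 𝓘(ℝ, E) I (extChartAt I u).symm z)))
    (extChartAt I u u)
    ![mfderiv I 𝓘(ℝ, E) (extChartAt I u) u x, mfderiv I 𝓘(ℝ, E) (extChartAt I u) u y]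

end Tensors

section Connections

variable {EM : Type*} [NormedAddCommGroup EM] [NormedSpace ℝ EM]
  {HM : Type*} [TopologicalSpace HM] (IM : ModelWithCorners ℝ EM HM)
  {EG : Type*} [NormedAddCommGroup EG] [NormedSpace ℝ EG] [FiniteDimensional ℝ EG]
  {HG : Type*} [TopologicalSpace HG] (IG : ModelWithCorners ℝ EG HG)
  {EP : Type*} [NormedAddCommGroup EP] [NormedSpace ℝ EP] [FiniteDimensional ℝ EP]
  {HP : Type*} [TopologicalSpace HP] (IP : ModelWithCorners ℝ EP HP)
  {M : Type*} [TopologicalSpace M] [ChartedSpace HM M]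
  {G : Type*} [TopologicalSpace G] [ChartedSpace HG G] [Group G]
  {P : Type*} [TopologicalSpace P] [ChartedSpace HP P] [IsManifold IP ∞ P] [MulAction Gᵐᵒᵖ P]

/-- `pr : P → M` is a smooth principal fibre bundle with structure group `G`, acting smoothly on the
right of `P` (written `u <• g`): there are smooth equivariant local trivialisations
`pr⁻¹(U) ≃ U × G`. -/
structure IsPrincipalBundle (pr : P → M) : Prop where
  smooth_proj : ContMDiff IP IM ∞ pr
  smooth_action : ContMDiff (IP.prod IG) IP ∞ (fun q : P × G => q.1 <• q.2)
  locally_trivial : ∀ m : M, ∃ U : Set M, IsOpen U ∧ m ∈ U ∧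
    ∃ φ : OpenPartialHomeomorph P (M × G),
      φ.source = pr ⁻¹' U ∧ φ.target = U ×ˢ (univ : Set G) ∧
      ContMDiffOn IP (IM.prod IG) ∞ φ φ.source ∧
      ContMDiffOn (IM.prod IG) IP ∞ φ.symm φ.target ∧
      (∀ u ∈ φ.source, (φ u).1 = pr u) ∧
      (∀ u ∈ φ.source, ∀ g : G, u <• g ∈ φ.source ∧ φ (u <• g) = (pr u, (φ u).2 * g))

/-- The vertical space `V_u = ker (dpr)_u`. -/
def vertical (pr : P → M) (u : P) : Submodule ℝ (TangentSpace IP u) :=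
  LinearMap.ker (mfderiv IP IM pr u).toLinearMap

/-- The differential at `u` of the right translation `R_g`. -/
def dRight (g : G) (u : P) : TangentSpace IP u →L[ℝ] TangentSpace IP (u <• g) :=
  mfderiv IP IP (fun p : P => p <• g) u

/-- The infinitesimal action `A ↦ A^*_u`, the value at `u` of the fundamental vector field of `A`:
the differential at `1` of `g ↦ u g`. (The tangent spaces at `u <• 1` and at `u` are identified
through `u <• 1 = u`; in Mathlib both unfold to the model space.) -/
def fundamental (u : P) : GroupLieAlgebra IG G →L[ℝ] TangentSpace IP u :=
  show TangentSpace IG (1 : G) →L[ℝ] TangentSpace IP (u <• (1 : G)) from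
    mfderiv IG IP (fun g : G => u <• g) (1 : G)

/-- A principal connection: a smooth `G`-invariant distribution `H` with `TP = V ⊕ H`. Smoothness
of `H` means that the projector of `TP` onto `H` along `V` is a smooth `(1,1)`-tensor field. -/
@[ext]
structure PrincipalConnection (pr : P → M) where
  hor : ∀ u : P, Submodule ℝ (TangentSpace IP u)
  isCompl : ∀ u : P, IsCompl (hor u) (vertical IM IP pr u)
  invariant : ∀ (g : G) (u : P),
    (hor u).map (dRight IP g u).toLinearMap = hor (u <• g)
  smooth : IsSmoothEndomorphismField IP
    (fun u => LinearMap.toContinuousLinearMap (Submodule.projection _ _ (isCompl u)))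

namespace PrincipalConnection

variable {IM IG IP}
variable {pr : P → M} (Γ : PrincipalConnection (G := G) IM IP pr)

/-- The horizontal projector `h`. -/
def horProj (u : P) : TangentSpace IP u →L[ℝ] TangentSpace IP u :=
  LinearMap.toContinuousLinearMap (Submodule.projection _ _ (Γ.isCompl u))

/-- The vertical projector `v`. -/
def vertProj (u : P) : TangentSpace IP u →L[ℝ] TangentSpace IP u :=
  LinearMap.toContinuousLinearMap (Submodule.projection _ _ (Γ.isCompl u).symm)

variable (IG)

/-- The connection one-form `ω`: `ω_u(x)` is the element `A` of the Lie algebra of `G` with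
`A^*_u = v x`. (On a principal bundle `A ↦ A^*_u` is injective with range `V_u`.) -/
def connForm (u : P) : TangentSpace IP u →L[ℝ] GroupLieAlgebra IG G :=
  LinearMap.toContinuousLinearMap
    ((fundamental IG IP u).toLinearMap.leftInverse ∘ₗ (Γ.vertProj u).toLinearMap)

/-- The curvature form `Ω(x, y) = dω(h x, h y)`. -/
def curvature (u : P) (x y : TangentSpace IP u) : GroupLieAlgebra IG G :=
  mextDeriv IP (F := EG) (fun p => Γ.connForm IG p) u (Γ.horProj u x) (Γ.horProj u y)

/-- The connection is flat: `Ω ≡ 0`. -/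
def IsFlat : Prop :=
  ∀ (u : P) (x y : TangentSpace IP u), Γ.curvature IG u x y = 0

end PrincipalConnection

/-- The two conditions on a `(1,1)`-tensor field `J` under which it indicates a connection:
the `ρ`-eigenvectors of `J` are exactly the vertical vectors, and `J` is `G`-invariant. -/
structure IndicatesConnection (pr : P → M) (a b : ℕ)
    (J : ∀ u : P, TangentSpace IP u →L[ℝ] TangentSpace IP u) : Prop where
  eigen_iff : ∀ (u : P) (x : TangentSpace IP u),
    J u x = metallicRatio a b • x ↔ x ∈ vertical IM IP pr u
  equivariant : ∀ (g : G) (u : P) (x : TangentSpace IP u),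
    dRight IP g u (J u x) = J (u <• g) (dRight IP g u x)

/-- `Γ` is the connection described by the metallic structure `J` (equivalently `J` is the metallic
structure associated with `Γ`): `J` satisfies the two conditions above and the horizontal spaces of
`Γ` are the eigenspaces of `J` for the other eigenvalue `a - ρ`. -/
structure IsDescribedBy {pr : P → M} (Γ : PrincipalConnection (G := G) IM IP pr) (a b : ℕ)
    (J : ∀ u : P, TangentSpace IP u →L[ℝ] TangentSpace IP u) : Prop where
  metallic : IsMetallicStructure IP a b J
  indicates : IndicatesConnection (G := G) IM IP pr a b J
  mem_hor_iff : ∀ (u : P) (x : TangentSpace IP u),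
    x ∈ Γ.hor u ↔ J u x = ((a : ℝ) - metallicRatio a b) • x

end Connections

end MetallicConnection

end

set_option linter.unusedSectionVars false

noncomputable section

namespace MetallicConnection

/-! Write ρ for the metallic ratio. The roots of x² - ax - b are ρ and a - ρ, and they differ by 2ρ
- a = √(a² + 4b) > 0. So a metallic J whose ρ-eigenspace is V splits TP into V and the (a -
ρ)-eigenspace, and J = (a - ρ) I + (2ρ - a) v. Thus J and the vertical projector v are affine
functions of each other with constant coefficients; smoothness and G-invariance pass between them,
which gives both bijection statements (`IsMetallicStructure.isCompl`, `IsDescribedBy.apply_eq`).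

The Nijenhuis tensor satisfies N_{cI + dK} = d² N_K (`nijenhuis_affine`), so it remains to treat v.
As ω ∘ v = ω, expanding gives ω(N_v(X, Y)) = ω([hX, hY]). As ω kills horizontal fields, Ω(X, Y) =
dω(hX, hY) = -ω([hX, hY]). This is the curvature formula. For flatness, N_v is vertical because V =
ker dπ is involutive (`mfderiv_mlieBracket_eq_zero`), and ω is injective on V; hence ω(N_v) = 0
forces N_v = 0.

The analytic input is the smoothness of ω: in a local trivialisation with group component ψ, ω is
the Maurer–Cartan pullback by ψ composed with v (`connForm_eq_of_isGauge`). -/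

lemma two_mul_metallicRatio_sub (a b : ℕ) :
    2 * metallicRatio a b - a = Real.sqrt ((a : ℝ) ^ 2 + 4 * (b : ℝ)) := by
  unfold metallicRatio; ring

lemma two_mul_metallicRatio_sub_pos (a : ℕ) {b : ℕ} (hb : 0 < b) :
    0 < 2 * metallicRatio a b - a := by
  rw [two_mul_metallicRatio_sub]
  positivity

lemma metallicRatio_sq (a b : ℕ) :
    metallicRatio a b ^ 2 = a * metallicRatio a b + b := by
  have h : Real.sqrt ((a : ℝ) ^ 2 + 4 * (b : ℝ)) ^ 2 = (a : ℝ) ^ 2 + 4 * (b : ℝ) :=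
    Real.sq_sqrt (by positivity)
  rw [← two_mul_metallicRatio_sub] at h
  linear_combination h / 4

/-! ### Smooth vector fields and endomorphism fields. -/

section Tensors

variable {E : Type*} [NormedAddCommGroup E] [NormedSpace ℝ E]
  {H : Type*} [TopologicalSpace H] {I : ModelWithCorners ℝ E H}
  {P : Type*} [TopologicalSpace P] [ChartedSpace H P] [IsManifold I ∞ P]

lemma isSmoothEndomorphismField_id :
    IsSmoothEndomorphismField I (fun u : P => ContinuousLinearMap.id ℝ (TangentSpace I u)) := by
  intro x₀
  rw [contMDiffAt_hom_bundle]
  refine ⟨contMDiffAt_id, ?_⟩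
  refine (contMDiffAt_const (c := ContinuousLinearMap.id ℝ E)).congr_of_eventuallyEq ?_
  filter_upwards [(trivializationAt E (TangentSpace I) x₀).open_baseSet.mem_nhds
    (FiberBundle.mem_baseSet_trivializationAt' x₀)] with x hx
  ext v
  simp only [ContinuousLinearMap.inCoordinates, ContinuousLinearMap.comp_apply,
    ContinuousLinearMap.id_apply]
  exact (trivializationAt E (TangentSpace I) x₀).continuousLinearMapAt_symmL hx v

lemma IsSmoothEndomorphismField.add {J K : ∀ u : P, TangentSpace I u →L[ℝ] TangentSpace I u}
    (hJ : IsSmoothEndomorphismField I J) (hK : IsSmoothEndomorphismField I K) :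
    IsSmoothEndomorphismField I (fun u => J u + K u) :=
  ContMDiff.add_section hJ hK

lemma IsSmoothEndomorphismField.const_smul
    {J : ∀ u : P, TangentSpace I u →L[ℝ] TangentSpace I u}
    (hJ : IsSmoothEndomorphismField I J) (c : ℝ) :
    IsSmoothEndomorphismField I (fun u => c • J u) :=
  ContMDiff.const_smul_section hJ

lemma IsSmoothVectorField.const_smul {X : ∀ u : P, TangentSpace I u}
    (hX : IsSmoothVectorField I X) (c : ℝ) : IsSmoothVectorField I (fun u => c • X u) :=
  ContMDiff.const_smul_section hX

lemma IsSmoothEndomorphismField.apply {J : ∀ u : P, TangentSpace I u →L[ℝ] TangentSpace I u}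
    {X : ∀ u : P, TangentSpace I u}
    (hJ : IsSmoothEndomorphismField I J) (hX : IsSmoothVectorField I X) :
    IsSmoothVectorField I (fun u => J u (X u)) :=
  ContMDiff.clm_bundle_apply hJ hX

lemma IsSmoothVectorField.mdifferentiableAt {X : ∀ u : P, TangentSpace I u}
    (hX : IsSmoothVectorField I X) (u : P) :
    MDifferentiableAt I I.tangent (fun u => (⟨u, X u⟩ : TangentBundle I P)) u :=
  (hX u).mdifferentiableAt (by simp)

/-- Every tangent vector extends to a global smooth vector field. -/
lemma exists_isSmoothVectorField_eq [FiniteDimensional ℝ E] [T2Space P] (u : P)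
    (x : TangentSpace I u) : ∃ X : ∀ u : P, TangentSpace I u, IsSmoothVectorField I X ∧ X u = x := by
  obtain ⟨s, hs, hX⟩ := FiberBundle.exists_contMDiffOn_extend I E (k := ∞) (V := TangentSpace I) x
  obtain ⟨t, hts, ht, hut⟩ := mem_nhds_iff.1 hs
  -- A bump function supported where the local extension is smooth; it equals 1 at `u`, so the value
  -- there is kept.
  obtain ⟨f, -, hf⟩ :=
    (SmoothBumpFunction.nhds_basis_tsupport (I := I) u).mem_iff.1 (ht.mem_nhds hut)
  refine ⟨fun p => f p • FiberBundle.extend E x p, ?_, by simp⟩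
  exact ContMDiffOn.smul_section_of_tsupport f.contMDiff.contMDiffOn ht hf (hX.mono hts)

end Tensors

section

variable {EN : Type*} [NormedAddCommGroup EN] [NormedSpace ℝ EN]
  {HN : Type*} [TopologicalSpace HN] {IN : ModelWithCorners ℝ EN HN}
  {N : Type*} [TopologicalSpace N] [ChartedSpace HN N]
  {EN' : Type*} [NormedAddCommGroup EN'] [NormedSpace ℝ EN']
  {HN' : Type*} [TopologicalSpace HN'] {IN' : ModelWithCorners ℝ EN' HN'}
  {N' : Type*} [TopologicalSpace N'] [ChartedSpace HN' N']

/-- Every tangent space unfolds to the model space, so a derivative moves between `u` and `u <• 1`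
without a cast. -/
lemma hasMFDerivAt_of_point_eq {f : N → N'} {x y : N} (h : x = y) {f' : EN →L[ℝ] EN'}
    (hf : HasMFDerivAt IN IN' f x f') : HasMFDerivAt IN IN' f y f' := by
  subst h
  exact hf

lemma continuousLinearMapAt_trivializationAt_self [IsManifold IN 1 N] {x y : N} (h : x = y)
    (v : EN) :
    (trivializationAt EN (TangentSpace IN) x).continuousLinearMapAt ℝ y v = v := by
  subst h
  rw [TangentBundle.continuousLinearMapAt_trivializationAt_eq_core (mem_chart_source HN x)]
  exact (tangentBundleCore IN N).coordChange_self (achart HN x) x (mem_chart_source HN x) v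

variable (IN) in
/-- The one-form `η` is smooth at `u`, read in the preferred trivialisation of the tangent bundle. -/
def IsSmoothOneFormAt [IsManifold IN ∞ N] {F : Type*} [NormedAddCommGroup F] [NormedSpace ℝ F]
    (η : ∀ p : N, TangentSpace IN p →L[ℝ] F) (u : N) : Prop :=
  ContMDiffAt IN 𝓘(ℝ, EN →L[ℝ] F) ∞
    (fun p : N => (η p).comp ((trivializationAt EN (TangentSpace IN) u).symmL ℝ p)) u

lemma IsSmoothOneFormAt.comp_endomorphism [IsManifold IN ∞ N] {F : Type*} [NormedAddCommGroup F]
    [NormedSpace ℝ F] {η : ∀ p : N, TangentSpace IN p →L[ℝ] F} {u : N}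
    (hη : IsSmoothOneFormAt IN η u) {J : ∀ p : N, TangentSpace IN p →L[ℝ] TangentSpace IN p}
    (hJ : IsSmoothEndomorphismField IN J) :
    IsSmoothOneFormAt IN (fun p => (η p).comp (J p)) u := by
  have h := ((contMDiffAt_hom_bundle _).1 (hJ u)).2
  refine (ContMDiffAt.clm_comp hη h).congr_of_eventuallyEq ?_
  filter_upwards [(trivializationAt EN (TangentSpace IN) u).open_baseSet.mem_nhds
    (FiberBundle.mem_baseSet_trivializationAt' u)] with p hp
  ext v
  simp only [ContinuousLinearMap.inCoordinates, ContinuousLinearMap.comp_apply]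
  exact congrArg (η p)
    ((trivializationAt EN (TangentSpace IN) u).symmL_continuousLinearMapAt hp _).symm

end

/-! ### Principal bundles, local gauges and the Maurer–Cartan pullback. -/

section Bundle

variable {EM : Type*} [NormedAddCommGroup EM] [NormedSpace ℝ EM]
  {HM : Type*} [TopologicalSpace HM] {IM : ModelWithCorners ℝ EM HM}
  {EG : Type*} [NormedAddCommGroup EG] [NormedSpace ℝ EG]
  {HG : Type*} [TopologicalSpace HG] {IG : ModelWithCorners ℝ EG HG}
  {EP : Type*} [NormedAddCommGroup EP] [NormedSpace ℝ EP]
  {HP : Type*} [TopologicalSpace HP] {IP : ModelWithCorners ℝ EP HP}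
  {M : Type*} [TopologicalSpace M] [ChartedSpace HM M]
  {G : Type*} [TopologicalSpace G] [ChartedSpace HG G] [Group G]
  {P : Type*} [TopologicalSpace P] [ChartedSpace HP P]
  [MulAction Gᵐᵒᵖ P] {pr : P → M}

namespace IsPrincipalBundle

lemma pr_rightSMul (hP : IsPrincipalBundle (G := G) IM IG IP pr) (u : P) (g : G) :
    pr (u <• g) = pr u := by
  obtain ⟨U, -, hU, φ, hs, -, -, -, hfst, hact⟩ := hP.locally_trivial (pr u)
  have hu : u ∈ φ.source := by rw [hs]; exact hU
  obtain ⟨h1, h2⟩ := hact u hu g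
  rw [← hfst _ h1, h2]

lemma contMDiff_right (hP : IsPrincipalBundle (G := G) IM IG IP pr) (g : G) :
    ContMDiff IP IP ∞ (fun p : P => p <• g) :=
  hP.smooth_action.comp (contMDiff_id.prodMk contMDiff_const)

lemma contMDiff_orbit (hP : IsPrincipalBundle (G := G) IM IG IP pr) (u : P) :
    ContMDiff IG IP ∞ (fun g : G => u <• g) :=
  hP.smooth_action.comp (contMDiff_const.prodMk contMDiff_id)

lemma mdifferentiableAt_right (hP : IsPrincipalBundle (G := G) IM IG IP pr) (g : G) (u : P) :
    MDifferentiableAt IP IP (fun p : P => p <• g) u :=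
  (hP.contMDiff_right g u).mdifferentiableAt (by simp)

lemma mdifferentiableAt_proj (hP : IsPrincipalBundle (G := G) IM IG IP pr) (u : P) :
    MDifferentiableAt IP IM pr u :=
  (hP.smooth_proj u).mdifferentiableAt (by simp)

lemma dRight_mem_vertical (hP : IsPrincipalBundle (G := G) IM IG IP pr) (g : G) (u : P)
    {x : TangentSpace IP u} (hx : x ∈ vertical IM IP pr u) :
    dRight IP g u x ∈ vertical IM IP pr (u <• g) := by
  have h := ((hP.mdifferentiableAt_proj (u <• g)).hasMFDerivAt.comp u
    (hP.mdifferentiableAt_right g u).hasMFDerivAt).mfderiv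
  have h2 : pr ∘ (fun p : P => p <• g) = pr := funext fun p => hP.pr_rightSMul p g
  rw [h2] at h
  have h3 := DFunLike.congr_fun h x
  exact h3.symm.trans hx

lemma dRight_injective (hP : IsPrincipalBundle (G := G) IM IG IP pr) (g : G) (u : P) :
    Function.Injective (dRight IP g u) := by
  have h := (hP.mdifferentiableAt_right g⁻¹ (u <• g)).hasMFDerivAt.comp u
    (hP.mdifferentiableAt_right g u).hasMFDerivAt
  have h2 : (fun p : P => p <• g⁻¹) ∘ (fun p : P => p <• g) = id :=
    funext fun p => by simp
  rw [h2] at h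
  have h3 := hasMFDerivAt_unique h (hasMFDerivAt_id u)
  intro x y hxy
  have hx := DFunLike.congr_fun h3 x
  have hy := DFunLike.congr_fun h3 y
  refine hx.symm.trans (Eq.trans ?_ hy)
  exact congrArg (mfderiv IP IP (fun p : P => p <• g⁻¹) (u <• g)) hxy

lemma dRight_surjective [FiniteDimensional ℝ EP] (hP : IsPrincipalBundle (G := G) IM IG IP pr)
    (g : G) (u : P) : Function.Surjective (dRight IP g u) :=
  (LinearMap.injective_iff_surjective_of_finrank_eq_finrank
    (f := (dRight IP g u).toLinearMap) rfl).1 (hP.dRight_injective g u)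

lemma fundamental_mem_vertical (hP : IsPrincipalBundle (G := G) IM IG IP pr) (u : P)
    (A : GroupLieAlgebra IG G) : fundamental IG IP u A ∈ vertical IM IP pr u := by
  have h := ((hasMFDerivAt_of_point_eq (by simp : u = u <• (1 : G))
    (hP.mdifferentiableAt_proj u).hasMFDerivAt).comp (1 : G)
    ((hP.contMDiff_orbit u 1).mdifferentiableAt (by simp)).hasMFDerivAt)
  have h2 : pr ∘ (fun g : G => u <• g) = fun _ => pr u := funext fun g => hP.pr_rightSMul u g
  rw [h2] at h
  exact DFunLike.congr_fun (hasMFDerivAt_unique h (hasMFDerivAt_const (pr u) (1 : G))) A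

end IsPrincipalBundle

variable (IM IG IP) in
/-- `ψ` is the group component of a local trivialisation of `pr` over the open set `W`. -/
structure IsGauge (pr : P → M) (W : Set P) (ψ : P → G) : Prop where
  isOpen : IsOpen W
  contMDiffOn : ContMDiffOn IP IG ∞ ψ W
  map_act : ∀ u ∈ W, ∀ g : G, ψ (u <• g) = ψ u * g
  eq_zero : ∀ u ∈ W, ∀ x ∈ vertical IM IP pr u, (mfderiv IP IG ψ u : EP →L[ℝ] EG) x = 0 → x = 0

/-- For `eq_zero`: near each point `φ.symm` is a left inverse of (pr, ψ), so the differential of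
(pr, ψ) is injective, and a vertical vector killed by dψ is zero. -/
lemma IsPrincipalBundle.exists_isGauge (hP : IsPrincipalBundle (G := G) IM IG IP pr) (u : P) :
    ∃ (W : Set P) (ψ : P → G), u ∈ W ∧ IsGauge IM IG IP pr W ψ := by
  obtain ⟨U, -, hU, φ, hs, -, hφ, hφs, hfst, hact⟩ := hP.locally_trivial (pr u)
  have hψ : ContMDiffOn IP IG ∞ (fun p => (φ p).2) φ.source :=
    contMDiff_snd.comp_contMDiffOn hφ
  refine ⟨φ.source, fun p => (φ p).2, by rw [hs]; exact hU, φ.open_source, hψ,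
    fun p hp g => by rw [(hact p hp g).2], ?_⟩
  intro p hp x hx hx'
  have h1 : HasMFDerivAt IP IG (fun p => (φ p).2) p (mfderiv IP IG (fun p => (φ p).2) p) :=
    ((hψ.contMDiffAt (φ.open_source.mem_nhds hp)).mdifferentiableAt (by simp)).hasMFDerivAt
  have h2 := (hP.mdifferentiableAt_proj p).hasMFDerivAt.prodMk h1
  have h3 : HasMFDerivAt (IM.prod IG) IP φ.symm (pr p, (φ p).2)
      (mfderiv (IM.prod IG) IP φ.symm (pr p, (φ p).2)) := by
    have : (pr p, (φ p).2) ∈ φ.target := by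
      rw [← hfst p hp]; exact φ.map_source hp
    exact ((hφs.contMDiffAt (φ.open_target.mem_nhds this)).mdifferentiableAt (by simp)).hasMFDerivAt
  have h4 := (HasMFDerivAt.comp p h3 h2)
  have h5 : (φ.symm ∘ fun y => (pr y, (φ y).2)) =ᶠ[nhds p] id := by
    filter_upwards [φ.open_source.mem_nhds hp] with q hq
    simp only [Function.comp_apply, ← hfst q hq, Prod.mk.eta, id_eq]
    exact φ.left_inv hq
  have h6 := DFunLike.congr_fun
    (hasMFDerivAt_unique h4 ((hasMFDerivAt_id p).congr_of_eventuallyEq h5)) x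
  refine h6.symm.trans ?_
  have h7 : ((mfderiv IP IM pr p).prod (mfderiv IP IG (fun p => (φ p).2) p)) x = 0 :=
    Prod.ext hx hx'
  exact (congrArg (mfderiv (IM.prod IG) IP φ.symm (pr p, (φ p).2)) h7).trans (map_zero _)

variable (IG IP) in
/-- The pull-back of the left Maurer–Cartan form by `ψ : P → G`. -/
def maurerCartanPullback (ψ : P → G) (u : P) : TangentSpace IP u →L[ℝ] GroupLieAlgebra IG G :=
  show EP →L[ℝ] EG from mfderiv IP IG (fun p => (ψ u)⁻¹ * ψ p) u

namespace IsGauge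

variable {W : Set P} {ψ : P → G}

lemma mdifferentiableAt_translate [LieGroup IG ∞ G] (hψ : IsGauge IM IG IP pr W ψ) {u : P} (hu : u ∈ W)
    (g : G) : MDifferentiableAt IP IG (fun p => g * ψ p) u :=
  (((contMDiff_mul_left (I := IG) (n := ∞) (a := g)).contMDiffAt.comp u
    (hψ.contMDiffOn.contMDiffAt (hψ.isOpen.mem_nhds hu)))).mdifferentiableAt (by simp)

/-- Along the orbit of `u`, (ψ u)⁻¹ ψ(u g) = g, whose differential at 1 is the identity. -/
lemma maurerCartanPullback_fundamental [LieGroup IG ∞ G]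
    (hP : IsPrincipalBundle (G := G) IM IG IP pr) (hψ : IsGauge IM IG IP pr W ψ)
    {u : P} (hu : u ∈ W) (A : GroupLieAlgebra IG G) :
    maurerCartanPullback IG IP ψ u (fundamental IG IP u A) = A := by
  have h := ((hasMFDerivAt_of_point_eq (by simp : u = u <• (1 : G))
    (hψ.mdifferentiableAt_translate hu (ψ u)⁻¹).hasMFDerivAt).comp (1 : G)
    ((hP.contMDiff_orbit u 1).mdifferentiableAt (by simp)).hasMFDerivAt)
  have h2 : (fun p => (ψ u)⁻¹ * ψ p) ∘ (fun g : G => u <• g) = id :=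
    funext fun g => by simp [hψ.map_act u hu g]
  rw [h2] at h
  exact DFunLike.congr_fun (hasMFDerivAt_unique h (hasMFDerivAt_id (1 : G))) A

lemma eq_zero_of_maurerCartanPullback [LieGroup IG ∞ G] (hψ : IsGauge IM IG IP pr W ψ)
    {u : P} (hu : u ∈ W) {x : TangentSpace IP u} (hx : x ∈ vertical IM IP pr u)
    (h0 : maurerCartanPullback IG IP ψ u x = 0) : x = 0 := by
  refine hψ.eq_zero u hu x hx ?_
  -- Left multiplication by `ψ u` undoes the translation in the Maurer–Cartan pullback and recovers
  -- dψ.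
  have h := (((contMDiff_mul_left (I := IG) (n := ∞) (a := ψ u)).contMDiffAt
    (x := (ψ u)⁻¹ * ψ u)).mdifferentiableAt (by simp)).hasMFDerivAt.comp u
    (hψ.mdifferentiableAt_translate hu (ψ u)⁻¹).hasMFDerivAt
  have h2 : (fun y => ψ u * y) ∘ (fun p => (ψ u)⁻¹ * ψ p) = ψ :=
    funext fun p => by simp
  rw [h2] at h
  refine (DFunLike.congr_fun h.mfderiv x).trans ?_
  exact (congrArg (mfderiv IG IG (fun y => ψ u * y) ((ψ u)⁻¹ * ψ u)) h0).trans (map_zero _)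

/-- The form is the derivative in q, on the diagonal, of the smooth map (p, q) ↦ ψ(p)⁻¹ ψ(q). On the
diagonal this map has constant value 1, so the coordinate change in the target is trivial. -/
lemma isSmoothOneFormAt_maurerCartanPullback [LieGroup IG ∞ G] [IsManifold IP ∞ P]
    (hψ : IsGauge IM IG IP pr W ψ) {u : P} (hu : u ∈ W) :
    IsSmoothOneFormAt IP (F := EG) (fun p => maurerCartanPullback IG IP ψ p) u := by
  have hs : ContMDiffAt IP IG ∞ ψ u := hψ.contMDiffOn.contMDiffAt (hψ.isOpen.mem_nhds hu)
  have h1 : ContMDiffAt (IP.prod IP) IG ∞ (Function.uncurry fun p q : P => (ψ p)⁻¹ * ψ q) (u, u) :=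
    (hs.comp (u, u) contMDiffAt_fst).inv.mul (hs.comp (u, u) contMDiffAt_snd)
  have h2 := ContMDiffAt.mfderiv (m := ∞) (fun p q : P => (ψ p)⁻¹ * ψ q) id h1 contMDiffAt_id
    (by simp)
  refine h2.congr_of_eventuallyEq (Filter.Eventually.of_forall fun p => ?_)
  simp only [inTangentCoordinates, id, ContinuousLinearMap.inCoordinates]
  ext v
  exact (continuousLinearMapAt_trivializationAt_self (IN := IG) (by simp) _).symm

end IsGauge
end Bundle

/-! ### Tangent vectors, brackets and one-forms in the preferred chart. -/

section Charts

variable {E : Type*} [NormedAddCommGroup E] [NormedSpace ℝ E]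
  {H : Type*} [TopologicalSpace H] {I : ModelWithCorners ℝ E H} [I.Boundaryless]
  {P : Type*} [TopologicalSpace P] [ChartedSpace H P] [IsManifold I ∞ P]

variable (I) in
/-- The vector field `X` read in the preferred chart at `u`. -/
def chartField (X : ∀ p : P, TangentSpace I p) (u : P) : E → E :=
  mpullbackWithin 𝓘(ℝ, E) I (extChartAt I u).symm X (range I)

/-- The tangent space at `u` is identified with the model space through the preferred chart at `u`
itself. -/
lemma mfderiv_extChartAt_self (u : P) :
    (mfderiv I 𝓘(ℝ, E) (extChartAt I u) u : E →L[ℝ] E) = ContinuousLinearMap.id ℝ E := by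
  rw [← TangentBundle.continuousLinearMapAt_trivializationAt (mem_chart_source H u)]
  exact ContinuousLinearMap.ext fun v : E =>
    continuousLinearMapAt_trivializationAt_self (IN := I) (x := u) rfl v

lemma mfderivWithin_extChartAt_symm_self (u : P) :
    (mfderivWithin 𝓘(ℝ, E) I (extChartAt I u).symm (range I) (extChartAt I u u) : E →L[ℝ] E) =
      ContinuousLinearMap.id ℝ E := by
  rw [← TangentBundle.symmL_trivializationAt (mem_chart_source H u),
    TangentBundle.symmL_trivializationAt_eq_core (mem_chart_source H u)]
  exact ContinuousLinearMap.ext fun v : E =>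
    (tangentBundleCore I P).coordChange_self (achart H u) u (mem_chart_source H u) v

lemma mlieBracket_eq_lieBracket_chartField (X Y : ∀ p : P, TangentSpace I p) (u : P) :
    (mlieBracket I X Y u : E) =
      lieBracket ℝ (chartField I X u) (chartField I Y u) (extChartAt I u u) := by
  rw [← mlieBracketWithin_univ, mlieBracketWithin_apply]
  have h := mfderiv_extChartAt_self (I := I) u
  refine (congrArg (fun A : E →L[ℝ] E => A.inverse _) h).trans ?_
  simp only [ContinuousLinearMap.inverse_id, ContinuousLinearMap.id_apply, I.range_eq_univ,
    preimage_univ, inter_univ]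
  rw [← lieBracketWithin_univ]
  simp only [chartField, I.range_eq_univ]

lemma differentiableAt_chartField [CompleteSpace E] {X : ∀ p : P, TangentSpace I p}
    (hX : IsSmoothVectorField I X) (u : P) :
    DifferentiableAt ℝ (chartField I X u) (extChartAt I u u) := by
  have : IsManifold I 2 P := IsManifold.of_le (n := ∞) ENat.LEInfty.out
  have h := (hX.mdifferentiableAt u).mdifferentiableWithinAt (s := univ)
    |>.differentiableWithinAt_mpullbackWithin_vectorField
  simp only [preimage_univ, univ_inter] at h
  rw [I.range_eq_univ] at h
  rw [← differentiableWithinAt_univ]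
  simp only [chartField, I.range_eq_univ]
  exact h

lemma chartField_self (X : ∀ p : P, TangentSpace I p) (u : P) :
    chartField I X u (extChartAt I u u) = X u := by
  have h : ∀ p : P, p = u → (X p : E) = X u := fun p hp => by subst hp; rfl
  refine (congrArg (fun A : E →L[ℝ] E => A.inverse _)
    (mfderivWithin_extChartAt_symm_self (I := I) u)).trans ?_
  simp only [ContinuousLinearMap.inverse_id]
  exact h _ (extChartAt_to_inv u)

lemma mfderiv_extChartAt_symm_chartField (X : ∀ p : P, TangentSpace I p) (u : P) :
    ∀ᶠ z in nhds (extChartAt I u u),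
      (show E →L[ℝ] E from mfderiv 𝓘(ℝ, E) I (extChartAt I u).symm z) (chartField I X u z) =
        X ((extChartAt I u).symm z) := by
  filter_upwards [extChartAt_target_mem_nhds (I := I) u] with z hz
  have h := isInvertible_mfderivWithin_extChartAt_symm (I := I) hz
  have h2 : mfderivWithin 𝓘(ℝ, E) I (extChartAt I u).symm (range I) z =
      mfderiv 𝓘(ℝ, E) I (extChartAt I u).symm z := by
    rw [I.range_eq_univ, mfderivWithin_univ]
  rw [← h2]
  exact h.self_apply_inverse _

lemma tendsto_extChartAt_symm (u : P) :
    Filter.Tendsto (extChartAt I u).symm (nhds (extChartAt I u u)) (nhds u) := by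
  have := (continuousAt_extChartAt_symm (I := I) u).tendsto
  rwa [extChartAt_to_inv] at this

lemma contMDiffAt_extChartAt_symm (u : P) :
    ContMDiffAt 𝓘(ℝ, E) I ∞ (extChartAt I u).symm (extChartAt I u u) := by
  have h := contMDiffWithinAt_extChartAt_symm_range (I := I) (n := ∞) u
    (mem_extChartAt_target (I := I) u)
  rwa [I.range_eq_univ, contMDiffWithinAt_univ] at h

lemma IsSmoothOneFormAt.differentiableAt_chart {F : Type*} [NormedAddCommGroup F]
    [NormedSpace ℝ F] {η : ∀ p : P, TangentSpace I p →L[ℝ] F} {u : P}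
    (hη : IsSmoothOneFormAt I η u) :
    DifferentiableAt ℝ (fun z : E => ((η ((extChartAt I u).symm z)).comp
      (mfderiv 𝓘(ℝ, E) I (extChartAt I u).symm z) : E →L[ℝ] F)) (extChartAt I u u) := by
  have h := ContMDiffAt.comp_of_eq (x := extChartAt I u u) hη (contMDiffAt_extChartAt_symm u)
    (extChartAt_to_inv (I := I) u)
  have h1 := (h.contDiffAt).differentiableAt (by simp)
  refine h1.congr_of_eventuallyEq ?_
  filter_upwards [extChartAt_target_mem_nhds (I := I) u] with z hz
  have hz' : (extChartAt I u).symm z ∈ (chartAt H u).source := by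
    rw [← extChartAt_source I u]
    exact (extChartAt I u).map_target hz
  simp only [Function.comp_apply]
  rw [TangentBundle.symmL_trivializationAt hz', (extChartAt I u).right_inv hz,
    I.range_eq_univ, mfderivWithin_univ]

end Charts

/-! ### Exterior derivative and Lie bracket in a vector space. -/

section VectorSpace

variable {E : Type*} [NormedAddCommGroup E] [NormedSpace ℝ E]
  {F : Type*} [NormedAddCommGroup F] [NormedSpace ℝ F]

/-- In dζ(V, W) = V ζ(W) - W ζ(V) - ζ([V, W]) the first two terms differentiate functions that
vanish near `z`. -/
lemma extDeriv_ofSubsingleton_of_apply_eq_zero {ζ : E → E →L[ℝ] F} {V W : E → E} {z : E}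
    (hζ : DifferentiableAt ℝ ζ z) (hV : DifferentiableAt ℝ V z) (hW : DifferentiableAt ℝ W z)
    (hζV : (fun y => ζ y (V y)) =ᶠ[nhds z] fun _ => 0)
    (hζW : (fun y => ζ y (W y)) =ᶠ[nhds z] fun _ => 0) :
    extDeriv (fun y => ContinuousAlternatingMap.ofSubsingleton ℝ E F (0 : Fin 1) (ζ y)) z
      ![V z, W z] = - ζ z (lieBracket ℝ V W z) := by
  have hd := extDeriv_apply_vectorField (x := z) (V := ![V, W])
    ((ContinuousAlternatingMap.ofSubsingletonLIE (𝕜 := ℝ) (E := E) (F := F)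
      (0 : Fin 1)).differentiableAt.comp z hζ)
    (by
      intro i
      fin_cases i
      · exact hV
      · exact hW)
  have hv : (fun i : Fin 2 => (![V, W] : Fin 2 → E → E) i z) = ![V z, W z] := by
    ext i; fin_cases i <;> rfl
  rw [hv] at hd
  refine hd.trans ?_
  have e1 : fderiv ℝ (fun y => ζ y (V y)) z = 0 := by rw [hζV.fderiv_eq]; simp
  have e2 : fderiv ℝ (fun y => ζ y (W y)) z = 0 := by rw [hζW.fderiv_eq]; simp
  simp [Fin.sum_univ_two, Fin.removeNth, ContinuousAlternatingMap.ofSubsingletonLIE, e1, e2]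

/-- Differentiating df(U) = 0 along w gives df(DU w) = -D²f(w, U). Taken on [V, W] = DW V - DV W,
the two second derivatives cancel by symmetry. -/
lemma fderiv_lieBracket_eq_zero {f : E → F} {V W : E → E} {z : E}
    (hf : ContDiffAt ℝ 2 f z) (hV : DifferentiableAt ℝ V z) (hW : DifferentiableAt ℝ W z)
    (hfV : (fun y => fderiv ℝ f y (V y)) =ᶠ[nhds z] fun _ => 0)
    (hfW : (fun y => fderiv ℝ f y (W y)) =ᶠ[nhds z] fun _ => 0) :
    fderiv ℝ f z (lieBracket ℝ V W z) = 0 := by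
  have hd : DifferentiableAt ℝ (fderiv ℝ f) z :=
    (hf.fderiv_right (m := 1) (by norm_num)).differentiableAt (by simp)
  have key : ∀ U : E → E, DifferentiableAt ℝ U z →
      ((fun y => fderiv ℝ f y (U y)) =ᶠ[nhds z] fun _ => 0) → ∀ w,
      fderiv ℝ f z (fderiv ℝ U z w) = - fderiv ℝ (fderiv ℝ f) z w (U z) := by
    intro U hU h w
    have h1 := (hd.hasFDerivAt.clm_apply hU.hasFDerivAt).fderiv
    rw [h.fderiv_eq] at h1
    have h2 := DFunLike.congr_fun h1 w
    simp at h2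
    exact eq_neg_of_add_eq_zero_left h2.symm
  have hs : IsSymmSndFDerivAt ℝ f z := hf.isSymmSndFDerivAt (by simp)
  rw [lieBracket, map_sub, key W hW hfW, key V hV hfV, hs.eq (V z) (W z)]
  simp

end VectorSpace

/-! ### Transfer of the two vector-space facts to manifolds. -/

section Charts

variable {E : Type*} [NormedAddCommGroup E] [NormedSpace ℝ E]
  {H : Type*} [TopologicalSpace H] {I : ModelWithCorners ℝ E H} [I.Boundaryless]
  {P : Type*} [TopologicalSpace P] [ChartedSpace H P] [IsManifold I ∞ P]

/-- If the one-form `η` annihilates the vector fields `X` and `Y`, then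
`dη(X, Y) = - η([X, Y])`. -/
lemma mextDeriv_apply_of_apply_eq_zero [CompleteSpace E] {F : Type*} [NormedAddCommGroup F]
    [NormedSpace ℝ F] {η : ∀ p : P, TangentSpace I p →L[ℝ] F} {u : P}
    (hη : IsSmoothOneFormAt I η u) {X Y : ∀ p : P, TangentSpace I p}
    (hX : IsSmoothVectorField I X) (hY : IsSmoothVectorField I Y)
    (hηX : ∀ p, η p (X p) = 0) (hηY : ∀ p, η p (Y p) = 0) :
    mextDeriv I η u (X u) (Y u) = - η u (mlieBracket I X Y u) := by
  set z₀ := extChartAt I u u with hz₀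
  set ζ : E → E →L[ℝ] F := fun z => (η ((extChartAt I u).symm z)).comp
      (mfderiv 𝓘(ℝ, E) I (extChartAt I u).symm z) with hζ
  have hζd : DifferentiableAt ℝ ζ z₀ := hη.differentiableAt_chart
  have hvan : ∀ Z : ∀ p : P, TangentSpace I p, (∀ p, η p (Z p) = 0) →
      (fun z => ζ z (chartField I Z u z)) =ᶠ[nhds z₀] fun _ => (0 : F) := by
    intro Z hZ
    filter_upwards [mfderiv_extChartAt_symm_chartField Z u] with z hz
    exact (congrArg (η _) hz).trans (hZ _)
  have hd := extDeriv_ofSubsingleton_of_apply_eq_zero hζd (differentiableAt_chartField hX u)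
    (differentiableAt_chartField hY u) (hvan X hηX) (hvan Y hηY)
  rw [chartField_self, chartField_self, ← mlieBracket_eq_lieBracket_chartField] at hd
  have hη' : ∀ p : P, p = u → (η p : E →L[ℝ] F) = η u := fun p hp => by subst hp; rfl
  have hζ₀ : ζ z₀ = η u := by
    have h1 := mfderivWithin_extChartAt_symm_self (I := I) u
    rw [I.range_eq_univ, mfderivWithin_univ] at h1
    ext w
    refine (congrArg (fun A : E →L[ℝ] E => η ((extChartAt I u).symm z₀) (A w)) h1).trans ?_
    exact DFunLike.congr_fun (hη' ((extChartAt I u).symm z₀) (extChartAt_to_inv u)) w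
  rw [hζ₀] at hd
  refine Eq.trans ?_ hd
  have hm := mfderiv_extChartAt_self (I := I) u
  unfold mextDeriv
  congr 1
  exact congrArg (fun A : E →L[ℝ] E => ![A (X u), A (Y u)]) hm

variable {E' : Type*} [NormedAddCommGroup E'] [NormedSpace ℝ E']
  {H' : Type*} [TopologicalSpace H'] {I' : ModelWithCorners ℝ E' H'} 
  {N : Type*} [TopologicalSpace N] [ChartedSpace H' N] [IsManifold I' ∞ N]

/-- The kernel of the differential of a smooth map is involutive. -/
lemma mfderiv_mlieBracket_eq_zero [CompleteSpace E] {f : P → N} (hf : ContMDiff I I' ∞ f)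
    {X Y : ∀ p : P, TangentSpace I p}
    (hX : IsSmoothVectorField I X) (hY : IsSmoothVectorField I Y)
    (hfX : ∀ p, mfderiv I I' f p (X p) = 0) (hfY : ∀ p, mfderiv I I' f p (Y p) = 0) (u : P) :
    mfderiv I I' f u (mlieBracket I X Y u) = 0 := by
  set z₀ := extChartAt I u u with hz₀
  set k : E → E' := writtenInExtChartAt I I' u f with hk
  have hk2 : ContDiffAt ℝ 2 k z₀ := by
    have h := ((contMDiffAt_iff_of_mem_source (mem_chart_source H u)
      (mem_chart_source H' (f u))).1 (hf u)).2
    rw [I.range_eq_univ, contDiffWithinAt_univ] at h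
    exact h.of_le ENat.LEInfty.out
  have hfu : (mfderiv I I' f u : E →L[ℝ] E') = fderiv ℝ k z₀ := by
    have h := ((hf u).mdifferentiableAt (by simp)).mfderiv
    rwa [I.range_eq_univ, fderivWithin_univ] at h
  -- Chain rule: dk is df between the chart differentials, and the inverse chart sends the chart
  -- field back to Z. Continuity of f keeps its values in the chart at `f u`.
  have hvan : ∀ Z : ∀ p : P, TangentSpace I p, (∀ p, mfderiv I I' f p (Z p) = 0) →
      (fun z => fderiv ℝ k z (chartField I Z u z)) =ᶠ[nhds z₀] fun _ => (0 : E') := by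
    intro Z hZ
    have hs : ∀ᶠ z in nhds z₀, f ((extChartAt I u).symm z) ∈ (chartAt H' (f u)).source := by
      refine (tendsto_extChartAt_symm (I := I) u).eventually
        ((hf.continuous.continuousAt (x := u)).eventually ?_)
      exact (chartAt H' (f u)).open_source.mem_nhds (mem_chart_source H' (f u))
    filter_upwards [mfderiv_extChartAt_symm_chartField Z u, hs,
      extChartAt_target_mem_nhds (I := I) u] with z hz hzs hzt
    have d1 : MDifferentiableAt 𝓘(ℝ, E) I (extChartAt I u).symm z := by
      have := mdifferentiableWithinAt_extChartAt_symm (I := I) hzt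
      rwa [I.range_eq_univ, mdifferentiableWithinAt_univ] at this
    have d2 : MDifferentiableAt I I' f ((extChartAt I u).symm z) :=
      (hf _).mdifferentiableAt (by simp)
    have d3 : MDifferentiableAt I' 𝓘(ℝ, E') (extChartAt I' (f u)) (f ((extChartAt I u).symm z)) :=
      mdifferentiableAt_extChartAt hzs
    have h := (d3.hasMFDerivAt.comp z (d2.hasMFDerivAt.comp z d1.hasMFDerivAt)).mfderiv
    have h' : fderiv ℝ k z = _ := mfderiv_eq_fderiv.symm.trans h
    rw [h']
    refine (congrArg (fun w => mfderiv I' 𝓘(ℝ, E') (extChartAt I' (f u))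
      (f ((extChartAt I u).symm z)) (mfderiv I I' f ((extChartAt I u).symm z) w)) hz).trans ?_
    exact (congrArg (mfderiv I' 𝓘(ℝ, E') (extChartAt I' (f u))
      (f ((extChartAt I u).symm z))) (hZ _)).trans (map_zero _)
  have h := fderiv_lieBracket_eq_zero hk2 (differentiableAt_chartField hX u)
    (differentiableAt_chartField hY u) (hvan X hfX) (hvan Y hfY)
  rw [← mlieBracket_eq_lieBracket_chartField, ← hfu] at h
  exact h

end Charts

/-! ### The Nijenhuis tensor under affine change. -/

section Nijenhuis

variable {E : Type*} [NormedAddCommGroup E] [NormedSpace ℝ E] [CompleteSpace E]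
  {H : Type*} [TopologicalSpace H] {I : ModelWithCorners ℝ E H}
  {P : Type*} [TopologicalSpace P] [ChartedSpace H P] [IsManifold I ∞ P]

lemma mlieBracket_affine_left {X X' Y : ∀ p : P, TangentSpace I p} (hX : IsSmoothVectorField I X)
    (hX' : IsSmoothVectorField I X') (c d : ℝ) (u : P) :
    mlieBracket I (fun p => c • X p + d • X' p) Y u =
      c • mlieBracket I X Y u + d • mlieBracket I X' Y u := by
  have : IsManifold I 2 P := IsManifold.of_le (n := ∞) ENat.LEInfty.out
  have h := mlieBracket_add_left (W := Y) ((hX.const_smul c).mdifferentiableAt u)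
    ((hX'.const_smul d).mdifferentiableAt u)
  refine h.trans ?_
  congr 1
  · exact mlieBracket_const_smul_left (hX.mdifferentiableAt u)
  · exact mlieBracket_const_smul_left (hX'.mdifferentiableAt u)

lemma mlieBracket_affine_right {X Y Y' : ∀ p : P, TangentSpace I p} (hY : IsSmoothVectorField I Y)
    (hY' : IsSmoothVectorField I Y') (c d : ℝ) (u : P) :
    mlieBracket I X (fun p => c • Y p + d • Y' p) u =
      c • mlieBracket I X Y u + d • mlieBracket I X Y' u := by
  rw [mlieBracket_swap_apply, mlieBracket_affine_left hY hY', mlieBracket_swap_apply (V := Y),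
    mlieBracket_swap_apply (V := Y'), smul_neg, smul_neg, neg_add, neg_neg, neg_neg]

/-- All terms with c² and cd cancel by bilinearity of the bracket alone; no polynomial relation on K
enters. -/
lemma nijenhuis_affine {J K : ∀ u : P, TangentSpace I u →L[ℝ] TangentSpace I u}
    (hK : IsSmoothEndomorphismField I K) {c d : ℝ} (hJ : ∀ u x, J u x = c • x + d • K u x)
    {X Y : ∀ p : P, TangentSpace I p} (hX : IsSmoothVectorField I X)
    (hY : IsSmoothVectorField I Y) (u : P) :
    nijenhuis I J X Y u = d ^ 2 • nijenhuis I K X Y u := by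
  simp only [nijenhuis, hJ, mlieBracket_affine_left hX (hK.apply hX),
    mlieBracket_affine_right hY (hK.apply hY), map_add, map_smul]
  module

end Nijenhuis

/-! ### The connection form, its curvature and the vertical projector. -/

section Connections

variable {EM : Type*} [NormedAddCommGroup EM] [NormedSpace ℝ EM]
  {HM : Type*} [TopologicalSpace HM] {IM : ModelWithCorners ℝ EM HM}
  {EG : Type*} [NormedAddCommGroup EG] [NormedSpace ℝ EG] [FiniteDimensional ℝ EG]
  {HG : Type*} [TopologicalSpace HG] {IG : ModelWithCorners ℝ EG HG}
  {EP : Type*} [NormedAddCommGroup EP] [NormedSpace ℝ EP] [FiniteDimensional ℝ EP]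
  {HP : Type*} [TopologicalSpace HP] {IP : ModelWithCorners ℝ EP HP}
  {M : Type*} [TopologicalSpace M] [ChartedSpace HM M]
  {G : Type*} [TopologicalSpace G] [ChartedSpace HG G] [Group G]
  {P : Type*} [TopologicalSpace P] [ChartedSpace HP P] [IsManifold IP ∞ P] [MulAction Gᵐᵒᵖ P]
  {pr : P → M}

namespace PrincipalConnection

variable (Γ : PrincipalConnection (G := G) IM IP pr) {u : P} {x : TangentSpace IP u}

lemma horProj_add_vertProj (x : TangentSpace IP u) : Γ.horProj u x + Γ.vertProj u x = x :=
  Submodule.projection_add_projection_eq_self (Γ.isCompl u) x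

lemma horProj_mem (x : TangentSpace IP u) : Γ.horProj u x ∈ Γ.hor u :=
  Submodule.projection_apply_mem (Γ.isCompl u) x

lemma vertProj_mem (x : TangentSpace IP u) : Γ.vertProj u x ∈ vertical IM IP pr u :=
  Submodule.projection_apply_mem (Γ.isCompl u).symm x

lemma vertProj_eq_zero_iff : Γ.vertProj u x = 0 ↔ x ∈ Γ.hor u :=
  Submodule.projection_apply_eq_zero_iff (Γ.isCompl u).symm

lemma vertProj_eq_self_iff : Γ.vertProj u x = x ↔ x ∈ vertical IM IP pr u :=
  Submodule.projection_eq_self_iff (Γ.isCompl u).symm x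

lemma vertProj_vertProj : Γ.vertProj u (Γ.vertProj u x) = Γ.vertProj u x :=
  Γ.vertProj_eq_self_iff.2 (Γ.vertProj_mem x)

lemma isSmooth_horProj : IsSmoothEndomorphismField IP Γ.horProj := Γ.smooth

lemma isSmooth_vertProj : IsSmoothEndomorphismField IP Γ.vertProj := by
  have h := isSmoothEndomorphismField_id.add (Γ.isSmooth_horProj.const_smul (-1))
  have e : Γ.vertProj = fun u =>
      ContinuousLinearMap.id ℝ (TangentSpace IP u) + (-1 : ℝ) • Γ.horProj u := by
    funext u
    refine ContinuousLinearMap.ext fun x => ?_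
    have := Γ.horProj_add_vertProj x
    simp only [add_apply, smul_apply,
      ContinuousLinearMap.id_apply]
    nth_rewrite 2 [← this]
    module
  rw [e]
  exact h

section ConnForm

variable [LieGroup IG ∞ G]

/-- The Maurer–Cartan pullback is a left inverse of `fundamental` and is injective on V. Hence every
vertical vector is a fundamental one, and the arbitrary choice in `leftInverse` does not affect
`connForm`. -/
lemma connForm_eq_of_isGauge (hP : IsPrincipalBundle (G := G) IM IG IP pr) {W : Set P} {ψ : P → G}
    (hψ : IsGauge IM IG IP pr W ψ) (hu : u ∈ W) (x : TangentSpace IP u) :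
    Γ.connForm IG u x = maurerCartanPullback IG IP ψ u (Γ.vertProj u x) := by
  set A := maurerCartanPullback IG IP ψ u (Γ.vertProj u x) with hA
  have hf : fundamental IG IP u A = Γ.vertProj u x := by
    refine sub_eq_zero.1 (hψ.eq_zero_of_maurerCartanPullback hu
      (Submodule.sub_mem _ (hP.fundamental_mem_vertical u A) (Γ.vertProj_mem x)) ?_)
    rw [map_sub, hψ.maurerCartanPullback_fundamental hP hu, sub_self]
  have hinj : LinearMap.ker (fundamental IG IP u).toLinearMap = ⊥ :=
    LinearMap.ker_eq_bot.2 (Function.LeftInverse.injective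
      (hψ.maurerCartanPullback_fundamental hP hu))
  have h := LinearMap.leftInverse_apply_of_inj hinj A
  change (fundamental IG IP u).toLinearMap.leftInverse (Γ.vertProj u x) = A
  rw [← hf]
  exact h

lemma connForm_eq_zero_iff (hP : IsPrincipalBundle (G := G) IM IG IP pr) :
    Γ.connForm IG u x = 0 ↔ Γ.vertProj u x = 0 := by
  obtain ⟨W, ψ, hu, hψ⟩ := hP.exists_isGauge u
  rw [Γ.connForm_eq_of_isGauge hP hψ hu]
  exact ⟨hψ.eq_zero_of_maurerCartanPullback hu (Γ.vertProj_mem x), fun h => by rw [h, map_zero]⟩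

lemma connForm_vertProj (hP : IsPrincipalBundle (G := G) IM IG IP pr) (x : TangentSpace IP u) :
    Γ.connForm IG u (Γ.vertProj u x) = Γ.connForm IG u x := by
  obtain ⟨W, ψ, hu, hψ⟩ := hP.exists_isGauge u
  rw [Γ.connForm_eq_of_isGauge hP hψ hu, Γ.connForm_eq_of_isGauge hP hψ hu, Γ.vertProj_vertProj]

lemma isSmoothOneFormAt_connForm (hP : IsPrincipalBundle (G := G) IM IG IP pr) (u : P) :
    IsSmoothOneFormAt IP (F := EG) (fun p => Γ.connForm IG p) u := by
  obtain ⟨W, ψ, hu, hψ⟩ := hP.exists_isGauge u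
  have h := (hψ.isSmoothOneFormAt_maurerCartanPullback hu).comp_endomorphism Γ.isSmooth_vertProj
  refine ContMDiffAt.congr_of_eventuallyEq h ?_
  filter_upwards [hψ.isOpen.mem_nhds hu] with p hp
  refine ContinuousLinearMap.ext fun w => ?_
  exact Γ.connForm_eq_of_isGauge hP hψ hp _

/-- Under ω each outer v disappears, leaving ω of [X, Y] + [vX, vY] - [vX, Y] - [X, vY], which is
the expansion of [X - vX, Y - vY]. -/
lemma connForm_nijenhuis_vertProj (hP : IsPrincipalBundle (G := G) IM IG IP pr)
    {X Y : ∀ p : P, TangentSpace IP p}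
    (hX : IsSmoothVectorField IP X) (hY : IsSmoothVectorField IP Y) (u : P) :
    Γ.connForm IG u (nijenhuis IP Γ.vertProj X Y u) =
      Γ.connForm IG u
        (mlieBracket IP (fun p => Γ.horProj p (X p)) (fun p => Γ.horProj p (Y p)) u) := by
  have e : ∀ Z : ∀ p : P, TangentSpace IP p, (fun p => Γ.horProj p (Z p)) =
      fun p => (1 : ℝ) • Z p + (-1 : ℝ) • Γ.vertProj p (Z p) := fun Z => by
    funext p
    have := Γ.horProj_add_vertProj (Z p)
    nth_rewrite 2 [← this]
    module
  have hvX := Γ.isSmooth_vertProj.apply hX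
  have hvY := Γ.isSmooth_vertProj.apply hY
  simp only [e, nijenhuis, mlieBracket_affine_left hX hvX, mlieBracket_affine_right hY hvY,
    map_add, map_sub, map_smul, Γ.connForm_vertProj hP]
  module

variable [IP.Boundaryless]

lemma curvature_apply (hP : IsPrincipalBundle (G := G) IM IG IP pr)
    {X Y : ∀ p : P, TangentSpace IP p}
    (hX : IsSmoothVectorField IP X) (hY : IsSmoothVectorField IP Y) (u : P) :
    Γ.curvature IG u (X u) (Y u) =
      -Γ.connForm IG u
        (mlieBracket IP (fun p => Γ.horProj p (X p)) (fun p => Γ.horProj p (Y p)) u) := by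
  have h0 : ∀ p (x : TangentSpace IP p), Γ.connForm IG p (Γ.horProj p x) = 0 := fun p x =>
    (Γ.connForm_eq_zero_iff hP).2 (Γ.vertProj_eq_zero_iff.2 (Γ.horProj_mem x))
  have : CompleteSpace EP := FiniteDimensional.complete ℝ EP
  exact mextDeriv_apply_of_apply_eq_zero (Γ.isSmoothOneFormAt_connForm hP u)
    (Γ.isSmooth_horProj.apply hX) (Γ.isSmooth_horProj.apply hY)
    (fun p => h0 p (X p)) (fun p => h0 p (Y p))

lemma curvature_apply_eq_nijenhuis_vertProj (hP : IsPrincipalBundle (G := G) IM IG IP pr)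
    {X Y : ∀ p : P, TangentSpace IP p}
    (hX : IsSmoothVectorField IP X) (hY : IsSmoothVectorField IP Y) (u : P) :
    Γ.curvature IG u (X u) (Y u) = -Γ.connForm IG u (nijenhuis IP Γ.vertProj X Y u) := by
  rw [Γ.connForm_nijenhuis_vertProj hP hX hY, Γ.curvature_apply hP hX hY]

lemma nijenhuis_vertProj_mem_vertical [IsManifold IM ∞ M]
    (hP : IsPrincipalBundle (G := G) IM IG IP pr) {X Y : ∀ p : P, TangentSpace IP p}
    (hX : IsSmoothVectorField IP X) (hY : IsSmoothVectorField IP Y) (u : P) :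
    nijenhuis IP Γ.vertProj X Y u ∈ vertical IM IP pr u := by
  have : CompleteSpace EP := FiniteDimensional.complete ℝ EP
  -- Three terms lie in the image of v; only [vX, vY] needs the involutivity of V.
  refine Submodule.sub_mem _ (Submodule.sub_mem _ (Submodule.add_mem _ (Γ.vertProj_mem _) ?_)
    (Γ.vertProj_mem _)) (Γ.vertProj_mem _)
  exact mfderiv_mlieBracket_eq_zero hP.smooth_proj (Γ.isSmooth_vertProj.apply hX)
    (Γ.isSmooth_vertProj.apply hY) (fun p => Γ.vertProj_mem (X p)) (fun p => Γ.vertProj_mem (Y p)) u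

lemma isFlat_iff_nijenhuis_vertProj [IsManifold IM ∞ M] [T2Space P]
    (hP : IsPrincipalBundle (G := G) IM IG IP pr) :
    Γ.IsFlat IG ↔ ∀ X Y : ∀ p : P, TangentSpace IP p,
      IsSmoothVectorField IP X → IsSmoothVectorField IP Y →
        ∀ u : P, nijenhuis IP Γ.vertProj X Y u = 0 := by
  constructor
  · intro hflat X Y hX hY u
    have h := hflat u (X u) (Y u)
    rw [Γ.curvature_apply_eq_nijenhuis_vertProj hP hX hY, neg_eq_zero,
      Γ.connForm_eq_zero_iff hP] at h
    rw [← h, eq_comm, Γ.vertProj_eq_self_iff]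
    exact Γ.nijenhuis_vertProj_mem_vertical hP hX hY u
  · intro hN u x y
    -- Curvature takes tangent vectors while the formula is for fields, so the vectors are extended
    -- globally.
    obtain ⟨X, hX, rfl⟩ := exists_isSmoothVectorField_eq u x
    obtain ⟨Y, hY, rfl⟩ := exists_isSmoothVectorField_eq u y
    rw [Γ.curvature_apply_eq_nijenhuis_vertProj hP hX hY, hN X Y hX hY, map_zero, neg_zero]

end ConnForm

lemma dRight_horProj (g : G) (u : P) (x : TangentSpace IP u) :
    dRight IP g u (Γ.horProj u x) ∈ Γ.hor (u <• g) := by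
  rw [← Γ.invariant g u]
  exact Submodule.mem_map_of_mem (Γ.horProj_mem x)

end PrincipalConnection

end Connections

/-! ### The correspondence between metallic structures and connections. -/

section Metallic

variable {EM : Type*} [NormedAddCommGroup EM] [NormedSpace ℝ EM]
  {HM : Type*} [TopologicalSpace HM] {IM : ModelWithCorners ℝ EM HM}
  {EG : Type*} [NormedAddCommGroup EG] [NormedSpace ℝ EG]
  {HG : Type*} [TopologicalSpace HG] {IG : ModelWithCorners ℝ EG HG}
  {EP : Type*} [NormedAddCommGroup EP] [NormedSpace ℝ EP] [FiniteDimensional ℝ EP]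
  {HP : Type*} [TopologicalSpace HP] {IP : ModelWithCorners ℝ EP HP}
  {M : Type*} [TopologicalSpace M] [ChartedSpace HM M]
  {G : Type*} [TopologicalSpace G] [ChartedSpace HG G] [Group G]
  {P : Type*} [TopologicalSpace P] [ChartedSpace HP P] [IsManifold IP ∞ P] [MulAction Gᵐᵒᵖ P]
  {pr : P → M} {a b : ℕ} {J : ∀ u : P, TangentSpace IP u →L[ℝ] TangentSpace IP u}

variable (IP) in
/-- The eigenspace of `J u` for the eigenvalue `a - ρ`. -/
def conjEigenspace (a b : ℕ) (J : ∀ u : P, TangentSpace IP u →L[ℝ] TangentSpace IP u) (u : P) :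
    Submodule ℝ (TangentSpace IP u) :=
  LinearMap.ker ((J u).toLinearMap - ((a : ℝ) - metallicRatio a b) • LinearMap.id)

lemma mem_conjEigenspace {u : P} {x : TangentSpace IP u} :
    x ∈ conjEigenspace IP a b J u ↔ J u x = ((a : ℝ) - metallicRatio a b) • x := by
  simp [conjEigenspace, sub_eq_zero]

/-- Lagrange interpolation at the two eigenvalues: the summands are the candidates for h x and v x.
-/
lemma conjEigenspace_decomp (hb : 0 < b) (u : P) (x : TangentSpace IP u) :
    (2 * metallicRatio a b - a)⁻¹ • (metallicRatio a b • x - J u x) +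
      (2 * metallicRatio a b - a)⁻¹ • (J u x - ((a : ℝ) - metallicRatio a b) • x) = x := by
  have hδ := (two_mul_metallicRatio_sub_pos a hb).ne'
  rw [← smul_add]
  have : metallicRatio a b • x - J u x + (J u x - ((a : ℝ) - metallicRatio a b) • x) =
      (2 * metallicRatio a b - a) • x := by module
  rw [this, smul_smul, inv_mul_cancel₀ hδ, one_smul]

lemma IsMetallicStructure.mem_conjEigenspace (hJ : IsMetallicStructure IP a b J) (u : P)
    (x : TangentSpace IP u) (c : ℝ) :
    c • (metallicRatio a b • x - J u x) ∈ conjEigenspace IP a b J u := by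
  have hb' : (b : ℝ) = metallicRatio a b ^ 2 - a * metallicRatio a b := by
    rw [metallicRatio_sq]; ring
  -- This is (J - (a - ρ))(J - ρ) = J² - aJ - b = 0, using ρ(a - ρ) = -b.
  refine Submodule.smul_mem _ _ (MetallicConnection.mem_conjEigenspace.2 ?_)
  rw [map_sub, map_smul, hJ.sq_eq, hb']
  module

lemma IsMetallicStructure.mem_vertical (hJ : IsMetallicStructure IP a b J)
    (hI : IndicatesConnection (G := G) IM IP pr a b J) (u : P)
    (x : TangentSpace IP u) (c : ℝ) :
    c • (J u x - ((a : ℝ) - metallicRatio a b) • x) ∈ vertical IM IP pr u := by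
  have hb' : (b : ℝ) = metallicRatio a b ^ 2 - a * metallicRatio a b := by
    rw [metallicRatio_sq]; ring
  refine Submodule.smul_mem _ _ ((hI.eigen_iff u _).1 ?_)
  rw [map_sub, map_smul, hJ.sq_eq, hb']
  module

lemma IsMetallicStructure.isCompl (hb : 0 < b) (hJ : IsMetallicStructure IP a b J)
    (hI : IndicatesConnection (G := G) IM IP pr a b J) (u : P) :
    IsCompl (conjEigenspace IP a b J u) (vertical IM IP pr u) := by
  have hδ := (two_mul_metallicRatio_sub_pos a hb).ne'
  refine ⟨Submodule.disjoint_def.2 fun x hx hv => ?_, codisjoint_iff.2 (eq_top_iff.2 fun x _ => ?_)⟩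
  · rw [MetallicConnection.mem_conjEigenspace, (hI.eigen_iff u x).2 hv] at hx
    have : (2 * metallicRatio a b - a) • x = 0 := by
      rw [← sub_eq_zero] at hx
      rw [← hx]
      module
    exact (smul_eq_zero.1 this).resolve_left hδ
  · exact Submodule.mem_sup.2 ⟨_, hJ.mem_conjEigenspace u x _, _, hJ.mem_vertical hI u x _,
      conjEigenspace_decomp hb u x⟩

lemma IsMetallicStructure.projection_eq (hb : 0 < b) (hJ : IsMetallicStructure IP a b J)
    (hI : IndicatesConnection (G := G) IM IP pr a b J) (u : P) (x : TangentSpace IP u) :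
    Submodule.projection _ _ (hJ.isCompl hb hI u) x =
      (2 * metallicRatio a b - a)⁻¹ • (metallicRatio a b • x - J u x) := by
  conv_lhs => rw [← conjEigenspace_decomp (a := a) (J := J) hb u x]
  rw [map_add, Submodule.projection_apply_of_mem_left _ (hJ.mem_conjEigenspace u x _),
    (Submodule.projection_apply_eq_zero_iff _).2 (hJ.mem_vertical hI u x _), add_zero]

/-- The connection described by a metallic structure. -/
def IsMetallicStructure.connection (hP : IsPrincipalBundle (G := G) IM IG IP pr) (hb : 0 < b)
    (hJ : IsMetallicStructure IP a b J) (hI : IndicatesConnection (G := G) IM IP pr a b J) :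
    PrincipalConnection (G := G) IM IP pr where
  hor := conjEigenspace IP a b J
  isCompl := hJ.isCompl hb hI
  invariant g u := by
    ext y
    rw [Submodule.mem_map]
    constructor
    · rintro ⟨x, hx, rfl⟩
      rw [MetallicConnection.mem_conjEigenspace] at hx ⊢
      refine (hI.equivariant g u x).symm.trans ?_
      rw [hx, map_smul]
      rfl
    · intro hy
      -- Bijectivity of dR_g lets the eigenvalue equation be pulled back to `u`.
      obtain ⟨x, rfl⟩ := hP.dRight_surjective g u y
      refine ⟨x, ?_, rfl⟩
      rw [MetallicConnection.mem_conjEigenspace] at hy ⊢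
      apply hP.dRight_injective g u
      rw [hI.equivariant, hy, map_smul]
  smooth := by
    -- The horizontal projector is (ρ I - J) / (2ρ - a), a constant-coefficient combination of
    -- smooth tensors.
    have h := ((isSmoothEndomorphismField_id (I := IP) (P := P)).const_smul
      ((2 * metallicRatio a b - a)⁻¹ * metallicRatio a b)).add
      (hJ.smooth.const_smul (-(2 * metallicRatio a b - a)⁻¹))
    convert h using 2 with u
    refine ContinuousLinearMap.ext fun x => (hJ.projection_eq hb hI u x).trans ?_
    simp only [add_apply, smul_apply, ContinuousLinearMap.id_apply]
    module

lemma IsMetallicStructure.isDescribedBy_connection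
    (hP : IsPrincipalBundle (G := G) IM IG IP pr) (hb : 0 < b)
    (hJ : IsMetallicStructure IP a b J) (hI : IndicatesConnection (G := G) IM IP pr a b J) :
    IsDescribedBy IM IP (hJ.connection hP hb hI) a b J :=
  ⟨hJ, hI, fun _ _ => MetallicConnection.mem_conjEigenspace⟩

lemma IsDescribedBy.connection_unique {Γ Γ' : PrincipalConnection (G := G) IM IP pr}
    (h : IsDescribedBy IM IP Γ a b J) (h' : IsDescribedBy IM IP Γ' a b J) : Γ = Γ' := by
  ext u x
  rw [h.mem_hor_iff, h'.mem_hor_iff]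

/-- J acts by a - ρ on H and by ρ on V. The formula yields uniqueness of J and the affine form
needed by `nijenhuis_affine`. -/
lemma IsDescribedBy.apply_eq {Γ : PrincipalConnection (G := G) IM IP pr}
    (h : IsDescribedBy IM IP Γ a b J) (u : P) (x : TangentSpace IP u) :
    J u x = ((a : ℝ) - metallicRatio a b) • x +
      (2 * metallicRatio a b - a) • Γ.vertProj u x := by
  have h1 := (h.mem_hor_iff u _).1 (Γ.horProj_mem x)
  have h2 := (h.indicates.eigen_iff u _).2 (Γ.vertProj_mem x)
  have h3 := Γ.horProj_add_vertProj x
  calc J u x = J u (Γ.horProj u x + Γ.vertProj u x) := by rw [h3]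
    _ = ((a : ℝ) - metallicRatio a b) • (Γ.horProj u x + Γ.vertProj u x) +
      (2 * metallicRatio a b - a) • Γ.vertProj u x := by rw [map_add, h1, h2]; module
    _ = _ := by rw [h3]

namespace PrincipalConnection

variable (Γ : PrincipalConnection (G := G) IM IP pr)

/-- The metallic structure associated with a connection. -/
def metallic (a b : ℕ) (u : P) : TangentSpace IP u →L[ℝ] TangentSpace IP u :=
  ((a : ℝ) - metallicRatio a b) • ContinuousLinearMap.id ℝ (TangentSpace IP u) +
    (2 * metallicRatio a b - a) • Γ.vertProj u

lemma metallic_apply (a b : ℕ) (u : P) (x : TangentSpace IP u) :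
    Γ.metallic a b u x = ((a : ℝ) - metallicRatio a b) • x +
      (2 * metallicRatio a b - a) • Γ.vertProj u x := rfl

lemma dRight_vertProj (hP : IsPrincipalBundle (G := G) IM IG IP pr) (g : G) (u : P)
    (x : TangentSpace IP u) :
    dRight IP g u (Γ.vertProj u x) = Γ.vertProj (u <• g) (dRight IP g u x) := by
  conv_rhs => rw [← Γ.horProj_add_vertProj x, map_add, map_add,
    Γ.vertProj_eq_zero_iff.2 (Γ.dRight_horProj g u x), zero_add]
  exact (Γ.vertProj_eq_self_iff.2 (hP.dRight_mem_vertical g u (Γ.vertProj_mem x))).symm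

lemma isDescribedBy_metallic (hP : IsPrincipalBundle (G := G) IM IG IP pr) (a : ℕ) (hb : 0 < b) :
    IsDescribedBy IM IP Γ a b (Γ.metallic a b) := by
  have hδ := (two_mul_metallicRatio_sub_pos a hb).ne'
  have hb' : (b : ℝ) = metallicRatio a b ^ 2 - a * metallicRatio a b := by
    rw [metallicRatio_sq]; ring
  refine ⟨⟨?_, fun u x => ?_⟩, ⟨fun u x => ?_, fun g u x => ?_⟩, fun u x => ?_⟩
  · exact (isSmoothEndomorphismField_id.const_smul _).add (Γ.isSmooth_vertProj.const_smul _)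
  · simp only [metallic_apply, map_add, map_smul, Γ.vertProj_vertProj, hb']
    module
  · rw [metallic_apply, ← Γ.vertProj_eq_self_iff, ← sub_eq_zero, ← sub_eq_zero (b := x)]
    have : ((a : ℝ) - metallicRatio a b) • x + (2 * metallicRatio a b - a) • Γ.vertProj u x -
        metallicRatio a b • x = (2 * metallicRatio a b - a) • (Γ.vertProj u x - x) := by module
    rw [this, smul_eq_zero, or_iff_right hδ]
  · rw [metallic_apply, metallic_apply, map_add, map_smul, map_smul, Γ.dRight_vertProj hP]
  · rw [metallic_apply, ← Γ.vertProj_eq_zero_iff, add_eq_left, smul_eq_zero, or_iff_right hδ]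

end PrincipalConnection

end Metallic

end MetallicConnection

end

/-! ### Assembly of the theorem. -/

theorem mainTheorem10
    {EM : Type*} [NormedAddCommGroup EM] [NormedSpace ℝ EM] [FiniteDimensional ℝ EM]
    {HM : Type*} [TopologicalSpace HM] (IM : ModelWithCorners ℝ EM HM) [IM.Boundaryless]
    {EG : Type*} [NormedAddCommGroup EG] [NormedSpace ℝ EG] [FiniteDimensional ℝ EG]
    {HG : Type*} [TopologicalSpace HG] (IG : ModelWithCorners ℝ EG HG) [IG.Boundaryless]
    {EP : Type*} [NormedAddCommGroup EP] [NormedSpace ℝ EP] [FiniteDimensional ℝ EP]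
    {HP : Type*} [TopologicalSpace HP] (IP : ModelWithCorners ℝ EP HP) [IP.Boundaryless]
    {M : Type*} [TopologicalSpace M] [T2Space M] [ChartedSpace HM M] [IsManifold IM ∞ M]
    {G : Type*} [TopologicalSpace G] [T2Space G] [ChartedSpace HG G] [Group G] [LieGroup IG ∞ G]
    {P : Type*} [TopologicalSpace P] [T2Space P] [ChartedSpace HP P] [IsManifold IP ∞ P]
    [MulAction Gᵐᵒᵖ P] (pr : P → M)
    (hP : MetallicConnection.IsPrincipalBundle (G := G) IM IG IP pr)
    (a b : ℕ) (ha : 0 < a) (hb : 0 < b) :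
    -- a metallic structure satisfying the two conditions describes exactly one connection
    (∀ J : ∀ u : P, TangentSpace IP u →L[ℝ] TangentSpace IP u,
      MetallicConnection.IsMetallicStructure IP a b J →
      MetallicConnection.IndicatesConnection (G := G) IM IP pr a b J →
      ∃! Γ : MetallicConnection.PrincipalConnection (G := G) IM IP pr,
        MetallicConnection.IsDescribedBy IM IP Γ a b J) ∧
    -- every connection has exactly one associated metallic structure
    (∀ Γ : MetallicConnection.PrincipalConnection (G := G) IM IP pr,
      ∃! J : ∀ u : P, TangentSpace IP u →L[ℝ] TangentSpace IP u,
        MetallicConnection.IsDescribedBy IM IP Γ a b J) ∧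
    -- the curvature formula, and flatness
    (∀ (Γ : MetallicConnection.PrincipalConnection (G := G) IM IP pr)
      (J : ∀ u : P, TangentSpace IP u →L[ℝ] TangentSpace IP u),
      MetallicConnection.IsDescribedBy IM IP Γ a b J →
      (∀ X Y : ∀ u : P, TangentSpace IP u,
        MetallicConnection.IsSmoothVectorField IP X →
        MetallicConnection.IsSmoothVectorField IP Y →
        ∀ u : P, Γ.curvature IG u (X u) (Y u) =
          (-(1 / (2 * MetallicConnection.metallicRatio a b - (a : ℝ)) ^ 2)) •
            Γ.connForm IG u (MetallicConnection.nijenhuis IP J X Y u)) ∧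
      (Γ.IsFlat IG ↔
        ∀ X Y : ∀ u : P, TangentSpace IP u,
          MetallicConnection.IsSmoothVectorField IP X →
          MetallicConnection.IsSmoothVectorField IP Y →
          ∀ u : P, MetallicConnection.nijenhuis IP J X Y u = 0)) := by
  have hδ := (MetallicConnection.two_mul_metallicRatio_sub_pos a hb).ne'
  have hE : CompleteSpace EP := FiniteDimensional.complete ℝ EP
  refine ⟨fun J hJ hI => ⟨hJ.connection hP hb hI, hJ.isDescribedBy_connection hP hb hI,
      fun Γ' h' => h'.connection_unique (hJ.isDescribedBy_connection hP hb hI)⟩,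
    fun Γ => ⟨Γ.metallic a b, Γ.isDescribedBy_metallic hP a hb, fun J hJ => ?_⟩,
    fun Γ J hJ => ?_⟩
  · funext u
    exact ContinuousLinearMap.ext fun x => hJ.apply_eq u x
  -- The factor (2ρ - a)² cancels the constant in the curvature formula and, being nonzero, makes
  -- N_J and N_v vanish together.
  · have hN : ∀ X Y : ∀ u : P, TangentSpace IP u,
        MetallicConnection.IsSmoothVectorField IP X → MetallicConnection.IsSmoothVectorField IP Y →
        ∀ u : P, MetallicConnection.nijenhuis IP J X Y u =
          (2 * MetallicConnection.metallicRatio a b - (a : ℝ)) ^ 2 •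
            MetallicConnection.nijenhuis IP Γ.vertProj X Y u := fun X Y hX hY u =>
      MetallicConnection.nijenhuis_affine Γ.isSmooth_vertProj hJ.apply_eq hX hY u
    refine ⟨fun X Y hX hY u => ?_, ?_⟩
    · rw [Γ.curvature_apply_eq_nijenhuis_vertProj hP hX hY, hN X Y hX hY, map_smul, smul_smul,
        neg_mul, one_div, inv_mul_cancel₀ (pow_ne_zero 2 hδ), neg_smul, one_smul]
    · rw [Γ.isFlat_iff_nijenhuis_vertProj hP]
      refine forall₂_congr fun X Y => forall₂_congr fun hX hY => forall_congr' fun u => ?_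
      rw [hN X Y hX hY, smul_eq_zero, or_iff_right (pow_ne_zero 2 hδ)]
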